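/- **Theorem.** Let $V$ be a real function on $\mathbb R^n$ and let $H=-\Delta+V(x)$ be a Schrödinger operator, self-adjoint on $L^2(\mathbb R^n)$ (that is, a self-adjoint operator with $Hf=-\Delta f+Vf$ in the sense of distributions, $Vf\in L^1_{loc}$, for all $f$ in its domain $D(H)$). Let $P_c(H)$ be the orthogonal projection onto the continuous spectral subspace of $H$, i.e. onto the orthogonal complement of the closed span of the eigenvectors of $H$, and write $\langle x\rangle=(1+|x|^2)^{1/2}$. Assume that for some real $\sigma$ and some constant $c$ the local decay estimate $$\int_0^\infty \|\langle x\rangle^{-\sigma}e^{-iHt}\psi\|_{L^2}^2\,dt\le c\,\|\psi\|_{L^2}^2\qquad\text{for all }\psi\in P_c(H)L^2$$ holds. Let $Q$ be a real locally integrable function on $\mathbb R^n$ whose distributional Laplacian is a locally integrable function, such that $\langle x\rangle^{2\sigma}(|Q(x)|+|\Delta Q(x)|)$ is (essentially) bounded. Then the integral $$B_V=\int_0^\infty e^{iHs}(-Q)e^{-iHs}P_c(H)\,ds,$$ understood through its form on the continuous spectral subspace, converges to a bounded operator on $L^2(\mathbb R^n)$. That is, there is a bounded operator $B_V$ on $L^2(\mathbb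 R^n)$ such that: 1. for all $\psi\in P_c(H)L^2$ and $\varphi\in L^2$, the function $s\mapsto\langle\psi,e^{iHs}(-Q)e^{-iHs}P_c(H)\varphi\rangle$ is absolutely integrable on $(0,\infty)$ and its integral is $\langle\psi,B_V\varphi\rangle$; 2. for all $\varphi\in L^2$, $s\mapsto e^{iHs}(-Q)e^{-iHs}P_c(H)\varphi$ is integrable on bounded intervals, and $P_c(H)\int_0^T e^{iHs}(-Q)e^{-iHs}P_c(H)\varphi\,ds\to B_V\varphi$ in $L^2$ as $T\to\infty$ (in particular $B_V$ is unique and has its range in $P_c(H)L^2$); 3. $i[H,B_V]=Q\,P_c(H)$ in the sense of forms on the continuous spectral subspace: for all $\psi\in D(H)\cap P_c(H)L^2$ and $\varphi\in D(H)$, $$i\big(\langle H\psi,B_V\varphi\rangle-\langle\psi,B_VH\varphi\rangle\big)=\langle\psi,Q\,P_c(H)\varphi\rangle .$$ -/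

import Mathlib

open scoped ContDiff InnerProductSpace
open MeasureTheory Filter Topology

namespace Adaptor

/-- The Hilbert space `L²(ℝⁿ; ℂ)`. -/
abbrev L2 (n : ℕ) : Type :=
  Lp ℂ 2 (volume : Measure (EuclideanSpace ℝ (Fin n)))

/-- `g = Δ f` in the sense of distributions on `ℝⁿ`. -/
def IsWeakLaplacian {n : ℕ} {F : Type*} [NormedAddCommGroup F] [NormedSpace ℝ F]
    (f g : EuclideanSpace ℝ (Fin n) → F) : Prop :=
  LocallyIntegrable f ∧ LocallyIntegrable g ∧
    ∀ φ : EuclideanSpace ℝ (Fin n) → ℝ, ContDiff ℝ ∞ φ → HasCompactSupport φ →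
      ∫ x, (Laplacian.laplacian φ x) • f x = ∫ x, φ x • g x

/-- `H` is a self-adjoint realization of `-Δ + V` on `L²(ℝⁿ)`: a densely defined self-adjoint
operator such that `H f = -Δ f + V f` in the sense of distributions for `f` in its domain. -/
structure IsSchrodingerOperator {n : ℕ} (V : EuclideanSpace ℝ (Fin n) → ℝ)
    (H : L2 n →ₗ.[ℂ] L2 n) : Prop where
  selfAdjoint : IsSelfAdjoint H
  eq_neg_laplacian_add : ∀ f : H.domain,
    IsWeakLaplacian (fun x => (f : L2 n) x) (fun x => V x • (f : L2 n) x - (H f) x)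

section Evolution

variable {E : Type*} [NormedAddCommGroup E] [InnerProductSpace ℂ E]

/-- `U` is the strongly continuous one-parameter unitary group with infinitesimal generator
`-i H`, i.e. `U t = e^{-itH}`. The last field says that the domain of `H` is exactly the set of
vectors `f` for which `t ↦ U t f` is differentiable at `0`, and that the derivative is `-i H f`. -/
structure IsUnitaryGroupOf (H : E →ₗ.[ℂ] E) (U : ℝ → E →L[ℂ] E) : Prop where
  zero : U 0 = 1
  add : ∀ s t, U (s + t) = U s * U t
  norm_map : ∀ t f, ‖U t f‖ = ‖f‖
  continuous : ∀ f, Continuous fun t => U t f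
  generator : ∀ f g, HasDerivAt (fun t => U t f) (-(Complex.I • g)) 0 ↔
    ∃ hf : f ∈ H.domain, H ⟨f, hf⟩ = g

/-- The unitary group generated by a self-adjoint operator is unique. -/
theorem IsUnitaryGroupOf.unique [CompleteSpace E] {H : E →ₗ.[ℂ] E} (hH : IsSelfAdjoint H)
    {U W : ℝ → E →L[ℂ] E} (hU : IsUnitaryGroupOf H U) (hW : IsUnitaryGroupOf H W) : U = W := by
  have hsymm : ∀ u : H.domain, (inner ℂ (H u) (u : E)) = inner ℂ (u : E) (H u) := by
    intro u
    have h := LinearPMap.adjoint_isFormalAdjoint (T := H) hH.dense_domain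
    rw [LinearPMap.isSelfAdjoint_def.mp hH] at h
    exact h u u
  have key : ∀ {Z : ℝ → E →L[ℂ] E}, IsUnitaryGroupOf H Z → ∀ f ∈ H.domain, ∀ t : ℝ,
      ∃ h : Z t f ∈ H.domain, HasDerivAt (fun s => Z s f) (-(Complex.I • H ⟨Z t f, h⟩)) t := by
    intro Z hZ f hf t
    have h0 := (hZ.generator f (H ⟨f, hf⟩)).2 ⟨hf, rfl⟩
    have h1 : HasDerivAt (fun s => Z s (Z t f)) (-(Complex.I • Z t (H ⟨f, hf⟩))) 0 := by
      have h2 := ((Z t).restrictScalars ℝ).hasFDerivAt.comp_hasDerivAt (0 : ℝ) h0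
      simp only [ContinuousLinearMap.coe_restrictScalars', map_neg, map_smul] at h2
      refine h2.congr_of_eventuallyEq (Eventually.of_forall fun s => ?_)
      change (Z s * Z t) f = (Z t * Z s) f
      rw [← hZ.add, ← hZ.add, add_comm]
    obtain ⟨h, he⟩ := (hZ.generator _ _).1 h1
    refine ⟨h, ?_⟩
    rw [he]
    have h3 : HasDerivAt (fun s : ℝ => s - t) 1 t := (hasDerivAt_id t).sub_const t
    have h1' : HasDerivAt (fun s => Z s (Z t f)) (-(Complex.I • Z t (H ⟨f, hf⟩))) (t - t) := by
      simpa using h1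
    have h4 := HasDerivAt.scomp (h := fun s : ℝ => s - t) t h1' h3
    rw [one_smul] at h4
    refine h4.congr_of_eventuallyEq (Eventually.of_forall fun s => ?_)
    change Z s f = (Z (s - t) * Z t) f
    rw [← hZ.add, sub_add_cancel]
  funext t
  refine ContinuousLinearMap.ext fun f => ?_
  have hcl : IsClosed {f : E | U t f = W t f} := isClosed_eq (U t).continuous (W t).continuous
  refine hcl.closure_subset_iff.2 (fun f hf => ?_) (hH.dense_domain f)
  have hd : ∀ s, HasDerivAt (fun s => ((inner ℂ (U s f - W s f) (U s f - W s f) : ℂ))) 0 s := by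
    intro s
    obtain ⟨h1, d1⟩ := key hU f hf s
    obtain ⟨h2, d2⟩ := key hW f hf s
    have hs := hsymm (⟨U s f, h1⟩ - ⟨W s f, h2⟩)
    have d := (d1.sub d2).inner ℂ (d1.sub d2)
    refine d.congr_deriv ?_
    rw [LinearPMap.map_sub] at hs
    simp only [Submodule.coe_sub] at hs
    have e : -(Complex.I • H ⟨U s f, h1⟩) - -(Complex.I • H ⟨W s f, h2⟩) =
        -(Complex.I • (H ⟨U s f, h1⟩ - H ⟨W s f, h2⟩)) := by
      rw [smul_sub]; abel
    rw [e, inner_neg_left, inner_neg_right, inner_smul_left, inner_smul_right]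
    simp only [Pi.sub_apply]
    rw [hs, Complex.conj_I]
    ring
  have hc := is_const_of_deriv_eq_zero (fun s => (hd s).differentiableAt)
    (fun s => (hd s).deriv) t 0
  have h0 : U 0 f - W 0 f = 0 := by rw [hU.zero, hW.zero]; simp
  simp only [h0, inner_self_eq_zero, inner_zero_left] at hc
  exact sub_eq_zero.1 hc

open Classical in
/-- The evolution `t ↦ e^{-itH}`: the (unique) strongly continuous unitary group generated by
`-i H`. For self-adjoint `H` it exists by Stone's theorem; otherwise the value is irrelevant. -/
noncomputable def evolution (H : E →ₗ.[ℂ] E) : ℝ → E →L[ℂ] E :=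
  if h : ∃ U, IsUnitaryGroupOf H U then h.choose else fun _ => 1

/-- The continuous spectral subspace of `H`: the orthogonal complement of the closed linear span
of all eigenvectors. -/
noncomputable def continuousSubspace (H : E →ₗ.[ℂ] E) : Submodule ℂ E :=
  (Submodule.span ℂ {f : E | ∃ (lam : ℝ) (hf : f ∈ H.domain),
    H ⟨f, hf⟩ = (lam : ℂ) • f}).topologicalClosureᗮ

/-- The orthogonal projection `P_c(H)` onto the continuous spectral subspace. -/
noncomputable def Pc [CompleteSpace E] (H : E →ₗ.[ℂ] E) : E →L[ℂ] E :=
  haveI : CompleteSpace (continuousSubspace H) :=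
    (Submodule.isClosed_orthogonal _).completeSpace_coe
  (continuousSubspace H).starProjection

end Evolution

/-- The Japanese bracket `⟨x⟩ = (1 + |x|²)^{1/2}`. -/
noncomputable def bracket {n : ℕ} (x : EuclideanSpace ℝ (Fin n)) : ℝ := √(1 + ‖x‖ ^ 2)

open Classical in
/-- The product `q f` of a real function `q` with `f ∈ L²(ℝⁿ)`, whenever it lies in `L²(ℝⁿ)`
(always the case for bounded measurable `q`); `0` otherwise. -/
noncomputable def mulFun {n : ℕ} (q : EuclideanSpace ℝ (Fin n) → ℝ) (f : L2 n) : L2 n :=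
  if h : MemLp (fun x => q x • f x) 2 volume then h.toLp _ else 0

/-- Local decay: `∫₀^∞ ‖⟨x⟩^{-σ} e^{-iHt} ψ‖² dt ≤ c ‖ψ‖²` for all `ψ` in the continuous
spectral subspace of `H`. -/
def LocalDecay {n : ℕ} (H : L2 n →ₗ.[ℂ] L2 n) (σ c : ℝ) : Prop :=
  ∀ ψ ∈ continuousSubspace H,
    ∫⁻ t in Set.Ioi (0 : ℝ), ∫⁻ x, ‖bracket x ^ (-σ) • (evolution H t ψ) x‖ₑ ^ 2
      ≤ ENNReal.ofReal c * ‖ψ‖ₑ ^ 2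

/-- The integrand `e^{iHs} (-Q) e^{-iHs} P_c(H) φ`. -/
noncomputable def integrand {n : ℕ} (H : L2 n →ₗ.[ℂ] L2 n)
    (Q : EuclideanSpace ℝ (Fin n) → ℝ) (φ : L2 n) (s : ℝ) : L2 n :=
  evolution H (-s) (-mulFun Q (evolution H s (Pc H φ)))

end Adaptor

/-! The bound on `Q` factors it as `Q = w N w`, with `w = ⟨x⟩^{-σ}` and `N = ⟨x⟩^{2σ} Q` bounded.
Hence `|⟨a, Q b⟩| ≤ K ‖w a‖ ‖w b‖` (`norm_inner_mulFun_le`). For `σ ≥ 0`, `w` is a bounded operator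
and local decay is Kato smoothness of `w` on the continuous subspace. Cauchy–Schwarz in time then
bounds the form `∫ ⟨P_c ψ, e^{iHs}(-Q)e^{-iHs} P_c φ⟩ ds` by a multiple of `‖ψ‖ ‖φ‖`, so it is
represented by a bounded operator (`exists_weak_integral`). The same estimate on `(T, ∞)`, uniform
over unit vectors `ψ`, makes the truncated integrals converge strongly.

For the commutator, the `s`-derivative of the matrix element of the integrand is `i` times the
commutator form. The matrix element and its derivative are both integrable, so the former vanishes
at infinity, and the fundamental theorem of calculus leaves only the value at `s = 0`
(`commutator_weak_integral`).

For `σ ≤ 0` the weight is at least `1` and the evolution is isometric, so local decay forces the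
continuous subspace to be zero.

That the evolution is a genuine unitary group is Stone's theorem, obtained from the bounded
approximations `a²H(H² + a²)⁻¹` of `H`. -/

namespace Adaptor

/-! ### Unitary groups and the invariance of the continuous subspace -/

section UnitaryGroup

variable {E : Type*} [NormedAddCommGroup E] [InnerProductSpace ℂ E]
  {H : E →ₗ.[ℂ] E} {U : ℝ → E →L[ℂ] E}

theorem IsUnitaryGroupOf.apply_neg_apply (hU : IsUnitaryGroupOf H U) (t : ℝ) (f : E) :
    U t (U (-t) f) = f := by
  change (U t * U (-t)) f = f
  rw [← hU.add, add_neg_cancel, hU.zero]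
  rfl

theorem IsUnitaryGroupOf.inner_apply_left (hU : IsUnitaryGroupOf H U) (t : ℝ) (f g : E) :
    ⟪U t f, g⟫_ℂ = ⟪f, U (-t) g⟫_ℂ := by
  let L : E →ₗᵢ[ℂ] E := ⟨(U t).toLinearMap, hU.norm_map t⟩
  have h := L.inner_map_map f (U (-t) g)
  change ⟪U t f, U t (U (-t) g)⟫_ℂ = _ at h
  rwa [hU.apply_neg_apply] at h

theorem IsUnitaryGroupOf.inner_apply_right (hU : IsUnitaryGroupOf H U) (t : ℝ) (f g : E) :
    ⟪f, U t g⟫_ℂ = ⟪U (-t) f, g⟫_ℂ := by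
  rw [hU.inner_apply_left, neg_neg]

/-- The group commutes with its generator. -/
theorem IsUnitaryGroupOf.generator_apply (hU : IsUnitaryGroupOf H U) (f : H.domain) (t : ℝ) :
    ∃ h : U t f ∈ H.domain, H ⟨U t f, h⟩ = U t (H f) := by
  have h0 := (hU.generator f (H f)).2 ⟨f.2, rfl⟩
  refine (hU.generator _ _).1 ?_
  have h2 := ((U t).restrictScalars ℝ).hasFDerivAt.comp_hasDerivAt (0 : ℝ) h0
  simp only [ContinuousLinearMap.coe_restrictScalars', map_neg, map_smul] at h2
  refine h2.congr_of_eventuallyEq (Eventually.of_forall fun s => ?_)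
  change (U s * U t) f = (U t * U s) f
  rw [← hU.add, ← hU.add, add_comm]

theorem IsUnitaryGroupOf.hasDerivAt (hU : IsUnitaryGroupOf H U) (f : H.domain) (t : ℝ) :
    HasDerivAt (fun s => U s f) (-(Complex.I • U t (H f))) t := by
  obtain ⟨h, he⟩ := hU.generator_apply f t
  have h1 : HasDerivAt (fun s => U s (U t f)) (-(Complex.I • U t (H f))) (t - t) := by
    rw [sub_self]
    exact (hU.generator _ _).2 ⟨h, he⟩
  have h4 := HasDerivAt.scomp (h := fun s : ℝ => s - t) t h1 ((hasDerivAt_id t).sub_const t)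
  rw [one_smul] at h4
  refine h4.congr_of_eventuallyEq (Eventually.of_forall fun s => ?_)
  change U s f = (U (s - t) * U t) f
  rw [← hU.add, sub_add_cancel]

theorem evolution_spec (h : ∃ U, IsUnitaryGroupOf H U) : IsUnitaryGroupOf H (evolution H) := by
  rw [evolution, dif_pos h]
  exact h.choose_spec

theorem isClosed_continuousSubspace : IsClosed (continuousSubspace H : Set E) :=
  Submodule.isClosed_orthogonal _

theorem mem_continuousSubspace_iff {f : E} :
    f ∈ continuousSubspace H ↔
      ∀ (lam : ℝ) (e : H.domain), H e = (lam : ℂ) • (e : E) → ⟪(e : E), f⟫_ℂ = 0 := by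
  rw [continuousSubspace, Submodule.orthogonal_closure]
  constructor
  · intro h lam e he
    exact h _ (Submodule.subset_span ⟨lam, e.2, he⟩)
  · intro h u hu
    induction hu using Submodule.span_induction with
    | mem x hx =>
      obtain ⟨lam, hx, he⟩ := hx
      exact h lam ⟨x, hx⟩ he
    | zero => simp
    | add x y _ _ hx hy => rw [inner_add_left, hx, hy, add_zero]
    | smul a x _ hx => rw [inner_smul_left, hx, mul_zero]

/-- The group commutes with `H`, so `U (-t)` carries eigenvectors to eigenvectors with the same
eigenvalue; orthogonality to all of them is preserved. -/
theorem IsUnitaryGroupOf.apply_mem_continuousSubspace (hU : IsUnitaryGroupOf H U) (t : ℝ) {f : E}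
    (hf : f ∈ continuousSubspace H) : U t f ∈ continuousSubspace H := by
  rw [mem_continuousSubspace_iff] at hf ⊢
  intro lam e he
  obtain ⟨h1, h2⟩ := hU.generator_apply e (-t)
  rw [hU.inner_apply_right]
  refine hf lam ⟨_, h1⟩ ?_
  rw [h2, he, map_smul]

/-- If `f` in the domain lies in the continuous spectral subspace, so does `H f`. -/
theorem IsUnitaryGroupOf.map_mem_continuousSubspace (hU : IsUnitaryGroupOf H U) (f : H.domain)
    (hf : (f : E) ∈ continuousSubspace H) : H f ∈ continuousSubspace H := by
  have hd := hU.hasDerivAt f 0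
  rw [hU.zero, one_apply_eq_self] at hd
  have h : -(Complex.I • H f) ∈ continuousSubspace H := by
    -- The difference quotients of `U s f` at `0` lie in the invariant subspace, which is closed.
    refine isClosed_continuousSubspace.mem_of_tendsto (hasDerivAt_iff_tendsto_slope.1 hd)
      (Eventually.of_forall fun s => ?_)
    rw [slope_def_module, ← Complex.coe_smul]
    exact Submodule.smul_mem _ _ (Submodule.sub_mem _ (hU.apply_mem_continuousSubspace s hf)
      (hU.apply_mem_continuousSubspace 0 hf))
  have h' := Submodule.smul_mem _ Complex.I h
  rwa [smul_neg, smul_smul, Complex.I_mul_I, neg_one_smul, neg_neg] at h'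

variable [CompleteSpace E]

instance : CompleteSpace (continuousSubspace H) :=
  isClosed_continuousSubspace.completeSpace_coe

theorem Pc_mem (f : E) : Pc H f ∈ continuousSubspace H :=
  Submodule.starProjection_apply_mem _ f

theorem Pc_eq_self {f : E} (hf : f ∈ continuousSubspace H) : Pc H f = f :=
  Submodule.starProjection_eq_self_iff.2 hf

theorem inner_Pc_left (f g : E) : ⟪Pc H f, g⟫_ℂ = ⟪f, Pc H g⟫_ℂ :=
  Submodule.inner_starProjection_left_eq_right _ f g

theorem norm_Pc_apply_le (f : E) : ‖Pc H f‖ ≤ ‖f‖ :=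
  Submodule.norm_starProjection_apply_le _ f

/-- The group commutes with the projection onto the continuous spectral subspace. -/
theorem IsUnitaryGroupOf.Pc_apply (hU : IsUnitaryGroupOf H U) (t : ℝ) (f : E) :
    Pc H (U t f) = U t (Pc H f) := by
  refine Submodule.eq_starProjection_of_mem_of_inner_eq_zero
    (hU.apply_mem_continuousSubspace t (Pc_mem f)) fun w hw => ?_
  rw [← map_sub, hU.inner_apply_left]
  exact Submodule.starProjection_inner_eq_zero f _ (hU.apply_mem_continuousSubspace (-t) hw)

/-- The generator commutes with the projection onto the continuous spectral subspace. -/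
theorem IsUnitaryGroupOf.map_Pc (hU : IsUnitaryGroupOf H U) (f : H.domain) :
    ∃ h : Pc H f ∈ H.domain, H ⟨Pc H f, h⟩ = Pc H (H f) := by
  have h0 := hU.hasDerivAt f 0
  rw [hU.zero, one_apply_eq_self] at h0
  refine (hU.generator _ _).1 ?_
  have h2 := ((Pc H).restrictScalars ℝ).hasFDerivAt.comp_hasDerivAt (0 : ℝ) h0
  simp only [ContinuousLinearMap.coe_restrictScalars', map_neg, map_smul] at h2
  refine h2.congr_of_eventuallyEq (Eventually.of_forall fun s => ?_)
  exact (hU.Pc_apply s f).symm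

end UnitaryGroup

/-! ### Resolvents at imaginary points and Yosida approximation -/

section Resolvent

variable {E : Type*} [NormedAddCommGroup E] [InnerProductSpace ℂ E] [CompleteSpace E]
  {H : E →ₗ.[ℂ] E}

theorem inner_map_left_of_isSelfAdjoint (hH : IsSelfAdjoint H) (u v : H.domain) :
    ⟪H u, (v : E)⟫_ℂ = ⟪(u : E), H v⟫_ℂ := by
  have h := LinearPMap.adjoint_isFormalAdjoint (T := H) hH.dense_domain
  rw [LinearPMap.isSelfAdjoint_def.mp hH] at h
  exact h u v

/-- A self-adjoint operator is maximal symmetric. -/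
theorem mem_domain_of_isSelfAdjoint (hH : IsSelfAdjoint H) {y w : E}
    (h : ∀ x : H.domain, ⟪w, (x : E)⟫_ℂ = ⟪y, H x⟫_ℂ) :
    ∃ hy : y ∈ H.domain, H ⟨y, hy⟩ = w := by
  have h1 := LinearPMap.mem_adjoint_domain_of_exists (T := H) y ⟨w, h⟩
  have h2 := LinearPMap.adjoint_apply_eq hH.dense_domain ⟨y, h1⟩ h
  have e := LinearPMap.isSelfAdjoint_def.mp hH
  have h3 : (y, w) ∈ H.adjoint.graph := (LinearPMap.mem_graph_iff _).2 ⟨⟨y, h1⟩, rfl, h2⟩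
  rw [e] at h3
  obtain ⟨z, hz1, hz2⟩ := (LinearPMap.mem_graph_iff _).1 h3
  dsimp only at hz1 hz2
  subst hz1
  exact ⟨z.2, hz2⟩

/-- The operator `H + i a` on the domain of `H`. -/
noncomputable def shifted (H : E →ₗ.[ℂ] E) (a : ℝ) : H.domain →ₗ[ℂ] E :=
  H.toFun + ((a : ℂ) * Complex.I) • H.domain.subtype

omit [CompleteSpace E] in
theorem shifted_apply (a : ℝ) (u : H.domain) :
    shifted H a u = H u + ((a : ℂ) * Complex.I) • (u : E) := rfl

omit [CompleteSpace E] in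
theorem shifted_eq_add (a b : ℝ) (u : H.domain) :
    shifted H a u = shifted H b u + (((a : ℂ) - b) * Complex.I) • (u : E) := by
  rw [shifted_apply, shifted_apply]
  module

/-- Symmetry makes `⟨u, H u⟩` real, so the imaginary part of `⟨u, (H + ia) u⟩` is exactly `a ‖u‖²`.
-/
theorem mul_norm_le_norm_shifted (hH : IsSelfAdjoint H) (a : ℝ) (u : H.domain) :
    |a| * ‖(u : E)‖ ≤ ‖shifted H a u‖ := by
  have h1 : (⟪(u : E), H u⟫_ℂ).im = 0 := by
    rw [← Complex.conj_eq_iff_im, inner_conj_symm]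
    exact inner_map_left_of_isSelfAdjoint hH u u
  have h2 : (⟪(u : E), shifted H a u⟫_ℂ).im = a * ‖(u : E)‖ ^ 2 := by
    have e : ⟪(u : E), (u : E)⟫_ℂ = ((‖(u : E)‖ ^ 2 : ℝ) : ℂ) := by
      rw [inner_self_eq_norm_sq_to_K, Complex.ofReal_pow]
      rfl
    rw [shifted_apply, inner_add_right, inner_smul_right, e, Complex.add_im, h1, mul_right_comm,
      ← Complex.ofReal_mul, zero_add, Complex.im_ofReal_mul, Complex.I_im,
      mul_one]
  have h3 : |a| * ‖(u : E)‖ ^ 2 ≤ ‖(u : E)‖ * ‖shifted H a u‖ := by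
    have h4 := (Complex.abs_im_le_norm _).trans (norm_inner_le_norm (𝕜 := ℂ) (u : E) (shifted H a u))
    rwa [h2, abs_mul, abs_of_nonneg (sq_nonneg ‖(u : E)‖)] at h4
  rcases (norm_nonneg (u : E)).eq_or_lt with h0 | h0
  · rw [← h0, mul_zero]; exact norm_nonneg _
  · refine le_of_mul_le_mul_left ?_ h0
    linarith

theorem shifted_injective (hH : IsSelfAdjoint H) {a : ℝ} (ha : a ≠ 0) :
    Function.Injective (shifted H a) := by
  rw [injective_iff_map_eq_zero]
  intro u hu
  have h := mul_norm_le_norm_shifted hH a u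
  rw [hu, norm_zero] at h
  have h' : ‖(u : E)‖ ≤ 0 := nonpos_of_mul_nonpos_right h (abs_pos.2 ha)
  exact Subtype.ext (norm_le_zero_iff.1 h')

/-- The graph of `H` is complete, and `(u, H u) ↦ H u + i a u` is bounded below on it. -/
theorem isClosed_range_shifted (hH : IsSelfAdjoint H) {a : ℝ} (ha : a ≠ 0) :
    IsClosed ((LinearMap.range (shifted H a) : Submodule ℂ E) : Set E) := by
  have hcomplete : CompleteSpace H.graph := hH.isClosed.completeSpace_coe
  let L : H.graph →L[ℂ] E := (ContinuousLinearMap.snd ℂ E E +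
    ((a : ℂ) * Complex.I) • ContinuousLinearMap.fst ℂ E E).comp H.graph.subtypeL
  have hL : ∀ p : H.graph, ∃ u : H.domain, (u : E) = p.1.1 ∧ H u = p.1.2 ∧ L p = shifted H a u := by
    intro p
    obtain ⟨u, h1, h2⟩ := (LinearPMap.mem_graph_iff _).1 p.2
    refine ⟨u, h1, h2, ?_⟩
    rw [shifted_apply, h1, h2]
    rfl
  have hrange : Set.range L = ((LinearMap.range (shifted H a) : Submodule ℂ E) : Set E) := by
    ext z
    constructor
    · rintro ⟨p, rfl⟩
      obtain ⟨u, -, -, h⟩ := hL p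
      exact ⟨u, h.symm⟩
    · rintro ⟨u, rfl⟩
      exact ⟨⟨(u, H u), LinearPMap.mem_graph _ u⟩, rfl⟩
  rw [← hrange]
  -- The term `|a|⁻¹` controls `‖u‖`, and `2` controls `‖H u‖` by the triangle inequality.
  have hanti : AntilipschitzWith (Real.toNNReal (2 + |a|⁻¹)) L := by
    refine L.antilipschitz_of_bound fun p => ?_
    obtain ⟨u, h1, h2, h3⟩ := hL p
    have hb := mul_norm_le_norm_shifted hH a u
    have hpos := abs_pos.2 ha
    have hu : ‖(u : E)‖ ≤ |a|⁻¹ * ‖shifted H a u‖ := by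
      rw [inv_mul_eq_div, le_div_iff₀ hpos, mul_comm]
      exact hb
    have hHu : ‖H u‖ ≤ 2 * ‖shifted H a u‖ := by
      have e : H u = shifted H a u - ((a : ℂ) * Complex.I) • (u : E) := by
        rw [shifted_apply, add_sub_cancel_right]
      rw [e]
      refine (norm_sub_le _ _).trans ?_
      rw [norm_smul, norm_mul, Complex.norm_I, Complex.norm_real, mul_one, Real.norm_eq_abs]
      linarith
    rw [Real.coe_toNNReal _ (by positivity), h3]
    have hn : ‖p‖ = max ‖(u : E)‖ ‖H u‖ := by rw [h1, h2]; rfl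
    rw [hn, add_mul]
    refine max_le ?_ ?_
    · have := norm_nonneg (shifted H a u)
      linarith
    · have : 0 ≤ |a|⁻¹ * ‖shifted H a u‖ := by positivity
      linarith
  exact hanti.isClosed_range L.uniformContinuous

/-- The range is closed, so it suffices that its orthogonal complement vanishes. A vector `y` there
satisfies `H y = i a y` by maximal symmetry, which injectivity of `H - i a` excludes unless `y = 0`.
-/
theorem shifted_surjective (hH : IsSelfAdjoint H) {a : ℝ} (ha : a ≠ 0) :
    Function.Surjective (shifted H a) := by
  rw [← LinearMap.range_eq_top]
  have hcl := isClosed_range_shifted hH ha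
  rw [← hcl.submodule_topologicalClosure_eq, Submodule.topologicalClosure_eq_top_iff,
    Submodule.eq_bot_iff]
  intro y hy
  obtain ⟨hyD, hHy⟩ := mem_domain_of_isSelfAdjoint hH (y := y) (w := ((a : ℂ) * Complex.I) • y)
    fun x => by
      have h : ⟪y, shifted H a x⟫_ℂ = 0 := (Submodule.mem_orthogonal' _ _).1 hy _ ⟨x, rfl⟩
      rw [shifted_apply, inner_add_right, inner_smul_right] at h
      rw [inner_smul_left, map_mul, Complex.conj_I, Complex.conj_ofReal]
      linear_combination -h
  have h0 : shifted H (-a) ⟨y, hyD⟩ = 0 := by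
    rw [shifted_apply, hHy]
    push_cast
    module
  have := shifted_injective hH (neg_ne_zero.2 ha) (h0.trans (map_zero _).symm)
  exact congrArg Subtype.val this

/-- `R` is the resolvent `(H + i a)⁻¹`. -/
structure IsResolventAt (H : E →ₗ.[ℂ] E) (a : ℝ) (R : E →L[ℂ] E) : Prop where
  exists_shifted : ∀ z, ∃ u : H.domain, (u : E) = R z ∧ shifted H a u = z
  apply_shifted : ∀ u : H.domain, R (shifted H a u) = u
  mul_norm_le : ∀ z, |a| * ‖R z‖ ≤ ‖z‖

theorem exists_isResolventAt (hH : IsSelfAdjoint H) {a : ℝ} (ha : a ≠ 0) :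
    ∃ R : E →L[ℂ] E, IsResolventAt H a R := by
  let e := LinearEquiv.ofBijective (shifted H a)
    ⟨shifted_injective hH ha, shifted_surjective hH ha⟩
  have he : ∀ z, shifted H a (e.symm z) = z := fun z => e.apply_symm_apply z
  have hb : ∀ z, |a| * ‖((e.symm z : H.domain) : E)‖ ≤ ‖z‖ := fun z => by
    simpa only [he] using mul_norm_le_norm_shifted hH a (e.symm z)
  refine ⟨(H.domain.subtype ∘ₗ e.symm.toLinearMap).mkContinuous |a|⁻¹ fun z => ?_,
    fun z => ⟨e.symm z, rfl, he z⟩, fun u => ?_, hb⟩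
  · rw [inv_mul_eq_div, le_div_iff₀ (abs_pos.2 ha), mul_comm]
    exact hb z
  · exact congrArg Subtype.val (e.symm_apply_apply u)

variable {a b : ℝ} {R S : E →L[ℂ] E}

theorem IsResolventAt.inner_left (hH : IsSelfAdjoint H) (hR : IsResolventAt H a R)
    (hS : IsResolventAt H (-a) S) (z z' : E) : ⟪R z, z'⟫_ℂ = ⟪z, S z'⟫_ℂ := by
  obtain ⟨u, hu, rfl⟩ := hR.exists_shifted z
  obtain ⟨v, hv, rfl⟩ := hS.exists_shifted z'
  rw [← hu, ← hv, shifted_apply, shifted_apply, inner_add_left, inner_add_right, inner_smul_left,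
    inner_smul_right, inner_map_left_of_isSelfAdjoint hH, map_mul, Complex.conj_I,
    Complex.conj_ofReal]
  push_cast
  ring

omit [CompleteSpace E] in
theorem IsResolventAt.commute (hR : IsResolventAt H a R) (hS : IsResolventAt H b S) :
    Commute R S := by
  refine ContinuousLinearMap.ext fun z => ?_
  change R (S z) = S (R z)
  obtain ⟨y, hy, rfl⟩ := hR.exists_shifted z
  obtain ⟨x, hx, hxy⟩ := hS.exists_shifted y
  have e : S (shifted H a y) = shifted H a x := by
    rw [shifted_eq_add a b y, map_add, map_smul, hS.apply_shifted, ← hx, shifted_eq_add a b x, hxy]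
  rw [e, hR.apply_shifted, ← hy, hx]

/-- The Yosida approximation of `H` built from the two resolvents at `± a`. -/
noncomputable def yosida (a : ℝ) (R S : E →L[ℂ] E) : E →L[ℂ] E :=
  ((a : ℂ) ^ 2 / 2) • (R + S)

omit [CompleteSpace E] in
-- Formally, `yosida` is `J H` with `J = (ia/2)(R - S) = a²(H² + a²)⁻¹`. The next two lemmas show
-- that `J` is a contraction and approaches the identity on the domain as `|a| → ∞`.
theorem yosida_apply_eq (hR : IsResolventAt H a R) (hS : IsResolventAt H (-a) S) (u : H.domain) :
    yosida a R S u = ((a : ℂ) * Complex.I / 2) • (R (H u) - S (H u)) := by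
  have h1 := hR.apply_shifted u
  have h2 := hS.apply_shifted u
  rw [shifted_apply, map_add, map_smul, ← eq_sub_iff_add_eq] at h1 h2
  rw [h1, h2]
  change ((a : ℂ) ^ 2 / 2) • (R u + S u) = _
  push_cast
  have hI : Complex.I * Complex.I = -1 := Complex.I_mul_I
  match_scalars
  · linear_combination ((a : ℂ) ^ 2 / 2) * hI
  · linear_combination ((a : ℂ) ^ 2 / 2) * hI
  · ring

omit [CompleteSpace E] in
theorem norm_yosida_sub_le (hR : IsResolventAt H a R) (hS : IsResolventAt H (-a) S) (z : E) :
    ‖((a : ℂ) * Complex.I / 2) • (R z - S z)‖ ≤ ‖z‖ := by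
  have h1 := hR.mul_norm_le z
  have h2 := hS.mul_norm_le z
  rw [abs_neg] at h2
  rw [norm_smul, norm_div, norm_mul, Complex.norm_I, Complex.norm_real, mul_one, Real.norm_eq_abs,
    RCLike.norm_ofNat]
  have h3 := mul_le_mul_of_nonneg_left (norm_sub_le (R z) (S z)) (abs_nonneg a)
  linarith

omit [CompleteSpace E] in
theorem norm_yosida_sub_sub_le (hR : IsResolventAt H a R) (hS : IsResolventAt H (-a) S)
    (u : H.domain) :
    |a| * ‖((a : ℂ) * Complex.I / 2) • (R u - S u) - (u : E)‖ ≤ ‖H u‖ := by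
  have h1 := hR.mul_norm_le (H u)
  have h2 := hS.mul_norm_le (H u)
  rw [abs_neg] at h2
  have e1 := hR.apply_shifted u
  have e2 := hS.apply_shifted u
  rw [shifted_apply, map_add, map_smul, ← eq_sub_iff_add_eq] at e1 e2
  have e : ((a : ℂ) * Complex.I / 2) • (R u - S u) - (u : E) =
      -((1 / 2 : ℂ) • (R (H u) + S (H u))) := by
    rw [e1, e2]
    push_cast
    module
  rw [e, norm_neg, norm_smul]
  have h3 := mul_le_mul_of_nonneg_left (norm_add_le (R (H u)) (S (H u))) (abs_nonneg a)
  have h4 : ‖(1 / 2 : ℂ)‖ = 1 / 2 := by simp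
  rw [h4]
  linarith

end Resolvent

/-! ### Stone's theorem -/

section Stone

variable {E : Type*} [NormedAddCommGroup E] [InnerProductSpace ℂ E]

omit [InnerProductSpace ℂ E] in
/-- For uniformly Lipschitz families, pointwise convergence extends from a dense set. -/
theorem tendsto_of_dense {ι : Type*} {l : Filter ι} {F : ι → E → E} {f : E → E} {K : NNReal}
    (hF : ∀ i, LipschitzWith K (F i)) (hf : Continuous f) {D : Set E} (hD : Dense D)
    (h : ∀ u ∈ D, Tendsto (fun i => F i u) l (𝓝 (f u))) (z : E) :
    Tendsto (fun i => F i z) l (𝓝 (f z)) := by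
  have hcl := (LipschitzWith.uniformEquicontinuous F K hF).equicontinuous.isClosed_setOfPred_tendsto
    (l := l) hf
  exact hcl.closure_subset_iff.2 h (hD z)

theorem cauchySeq_of_dense {F : ℕ → E →L[ℂ] E} (hF : ∀ i f, ‖F i f‖ = ‖f‖) {D : Set E}
    (hD : Dense D) (h : ∀ u ∈ D, CauchySeq fun i => F i u) (z : E) :
    CauchySeq fun i => F i z := by
  have key : ∀ z, CauchySeq (fun i => F i z) ↔
      Tendsto (fun p : ℕ × ℕ => F p.1 z - F p.2 z) atTop (𝓝 0) := fun z => by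
    rw [cauchySeq_iff_tendsto_dist_atTop_0]
    simp only [dist_eq_norm]
    exact tendsto_zero_iff_norm_tendsto_zero.symm
  rw [key]
  have hL : ∀ i, LipschitzWith 1 (F i) := fun i => by
    refine LipschitzWith.of_dist_le_mul fun x y => ?_
    rw [dist_eq_norm, dist_eq_norm, ← map_sub, hF, NNReal.coe_one, one_mul]
  exact tendsto_of_dense (F := fun p : ℕ × ℕ => fun z => F p.1 z - F p.2 z) (f := fun _ => 0)
    (fun p => (hL p.1).sub (hL p.2)) continuous_const hD (fun u hu => (key u).1 (h u hu)) z

variable [CompleteSpace E]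

/-- The one-parameter group `e^{tB}` generated by a bounded operator. -/
noncomputable def expGroup (B : E →L[ℂ] E) (t : ℝ) : E →L[ℂ] E := NormedSpace.exp (t • B)

variable {B B' : E →L[ℂ] E}

theorem expGroup_zero : expGroup B 0 = 1 := by
  rw [expGroup, zero_smul, NormedSpace.exp_zero]

theorem expGroup_add (s t : ℝ) : expGroup B (s + t) = expGroup B s * expGroup B t := by
  let +nondep : NormedAlgebra ℚ (E →L[ℂ] E) := .restrictScalars ℚ ℂ _
  rw [expGroup, add_smul]
  exact NormedSpace.exp_add_of_commute (((Commute.refl B).smul_left s).smul_right t)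

theorem norm_expGroup_apply (hB : B ∈ skewAdjoint (E →L[ℂ] E)) (t : ℝ) (f : E) :
    ‖expGroup B t f‖ = ‖f‖ := by
  let +nondep : NormedAlgebra ℚ (E →L[ℂ] E) := .restrictScalars ℚ ℂ _
  refine ContinuousLinearMap.norm_map_of_mem_unitary ?_ f
  exact NormedSpace.exp_mem_unitary_of_mem_skewAdjoint (skewAdjoint.smul_mem t hB)

theorem hasDerivAt_expGroup_apply (f : E) (t : ℝ) :
    HasDerivAt (fun s => expGroup B s f) (expGroup B t (B f)) t :=
  ((ContinuousLinearMap.apply ℂ E f).restrictScalars ℝ).hasFDerivAt.comp_hasDerivAt t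
    (hasDerivAt_exp_smul_const B t)

theorem norm_expGroup_apply_sub_le (hB : B ∈ skewAdjoint (E →L[ℂ] E)) (f : E) (s t : ℝ) :
    ‖expGroup B t f - expGroup B s f‖ ≤ ‖B f‖ * |t - s| := by
  have h := Convex.norm_image_sub_le_of_norm_hasDerivWithin_le (s := Set.univ) (C := ‖B f‖)
    (f := fun s => expGroup B s f) (f' := fun s => expGroup B s (B f))
    (fun x _ => (hasDerivAt_expGroup_apply f x).hasDerivWithinAt)
    (fun x _ => (norm_expGroup_apply hB x (B f)).le) convex_univ (Set.mem_univ s) (Set.mem_univ t)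
  exact h

/-- Commutation gives `exp (tB) = exp (tB') exp (t(B - B'))`. Removing the isometry `exp (tB')`
leaves the distance of `exp (t(B - B'))` from the identity, which the mean value inequality bounds.
-/
theorem norm_expGroup_sub_expGroup_apply_le (hB : B ∈ skewAdjoint (E →L[ℂ] E))
    (hB' : B' ∈ skewAdjoint (E →L[ℂ] E)) (hc : Commute B B') (f : E) (t : ℝ) :
    ‖expGroup B t f - expGroup B' t f‖ ≤ |t| * ‖B f - B' f‖ := by
  have e : expGroup B t = expGroup B' t * expGroup (B - B') t := by
    let +nondep : NormedAlgebra ℚ (E →L[ℂ] E) := .restrictScalars ℚ ℂ _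
    have hc' : Commute (t • B') (t • (B - B')) :=
      ((hc.symm.sub_right (Commute.refl B')).smul_left t).smul_right t
    rw [expGroup, expGroup, expGroup, ← NormedSpace.exp_add_of_commute hc', ← smul_add,
      add_sub_cancel]
  have h := norm_expGroup_apply_sub_le ((skewAdjoint (E →L[ℂ] E)).sub_mem hB hB') f 0 t
  rw [expGroup_zero, sub_zero, mul_comm] at h
  have e2 : expGroup B t f - expGroup B' t f =
      expGroup B' t (expGroup (B - B') t f - (1 : E →L[ℂ] E) f) := by
    rw [e, map_sub]
    rfl
  rw [e2, norm_expGroup_apply hB']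
  exact h

variable {H : E →ₗ.[ℂ] E}

/-- A self-adjoint operator is approximated, strongly on its domain, by commuting bounded
self-adjoint operators; here these are multiplied by `-i`. -/
theorem exists_yosida (hH : IsSelfAdjoint H) :
    ∃ B : ℕ → E →L[ℂ] E, (∀ k, B k ∈ skewAdjoint (E →L[ℂ] E)) ∧ (∀ k l, Commute (B k) (B l)) ∧
      ∀ u : H.domain, Tendsto (fun k => B k u) atTop (𝓝 (-(Complex.I • H u))) := by
  have hne : ∀ k : ℕ, ((k : ℝ) + 1) ≠ 0 := fun k => by positivity
  choose R hR using fun k : ℕ => exists_isResolventAt hH (hne k)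
  choose S hS using fun k : ℕ => exists_isResolventAt hH (neg_ne_zero.2 (hne k))
  -- The regularizer `a²(H² + a²)⁻¹` at `a = k + 1`; it tends strongly to the identity.
  let J : ℕ → E →L[ℂ] E := fun k => ((((k : ℝ) + 1 : ℝ) : ℂ) * Complex.I / 2) • (R k - S k)
  have hJ : ∀ z, Tendsto (fun k => J k z) atTop (𝓝 z) := by
    refine tendsto_of_dense (K := 1) (F := fun k => J k) (f := id) (fun k => ?_) continuous_id
      hH.dense_domain fun u hu => ?_
    · refine LipschitzWith.of_dist_le_mul fun x y => ?_
      rw [dist_eq_norm, dist_eq_norm, ← map_sub, NNReal.coe_one, one_mul]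
      exact norm_yosida_sub_le (hR k) (hS k) (x - y)
    · rw [tendsto_iff_norm_sub_tendsto_zero]
      have hlim : Tendsto (fun k : ℕ => ‖H ⟨u, hu⟩‖ * (1 / ((k : ℝ) + 1))) atTop (𝓝 0) := by
        simpa using tendsto_one_div_add_atTop_nhds_zero_nat.const_mul ‖H ⟨u, hu⟩‖
      refine squeeze_zero (fun _ => norm_nonneg _) (fun k => ?_) hlim
      have h := norm_yosida_sub_sub_le (hR k) (hS k) ⟨u, hu⟩
      have hpos : (0 : ℝ) < k + 1 := by positivity
      rw [abs_of_pos hpos] at h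
      rw [mul_one_div, le_div_iff₀ hpos, mul_comm]
      exact h
  refine ⟨fun k => -(Complex.I • yosida ((k : ℝ) + 1) (R k) (S k)), fun k => ?_, fun k l => ?_,
    fun u => ?_⟩
  · have hRS : star (R k) = S k := by
      rw [ContinuousLinearMap.star_eq_adjoint, eq_comm, ContinuousLinearMap.eq_adjoint_iff]
      intro x y
      rw [← inner_conj_symm, ← (hR k).inner_left hH (hS k), inner_conj_symm]
    have hSR : star (S k) = R k := by rw [← hRS, star_star]
    rw [skewAdjoint.mem_iff, star_neg, star_smul, yosida, star_smul, star_add, hRS, hSR]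
    simp [yosida, add_comm]
  · have c1 := (hR k).commute (hR l)
    have c2 := (hR k).commute (hS l)
    have c3 := (hS k).commute (hR l)
    have c4 := (hS k).commute (hS l)
    have c : Commute (R k + S k) (R l + S l) :=
      (c1.add_right c2).add_left (c3.add_right c4)
    exact (((((c.smul_left _).smul_right _).smul_left _).smul_right _).neg_left).neg_right
  · have h := ((hJ (H u)).const_smul Complex.I).neg
    refine h.congr fun k => ?_
    change _ = -(Complex.I • yosida ((k : ℝ) + 1) (R k) (S k) u)
    rw [yosida_apply_eq (hR k) (hS k)]
    rfl

/-- **Stone's theorem**, existence: a self-adjoint operator generates a strongly continuous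
unitary group. -/
theorem exists_isUnitaryGroupOf (hH : IsSelfAdjoint H) : ∃ U, IsUnitaryGroupOf H U := by
  obtain ⟨B, hB, hcomm, hlim⟩ := exists_yosida hH
  have hiso := fun k => norm_expGroup_apply (hB k)
  have hcauchy : ∀ t f, CauchySeq fun k => expGroup (B k) t f := by
    intro t
    refine cauchySeq_of_dense (fun k => hiso k t) hH.dense_domain fun u hu => ?_
    have hc := (hlim ⟨u, hu⟩).cauchySeq
    rw [cauchySeq_iff_tendsto_dist_atTop_0] at hc ⊢
    have hc' := hc.const_mul |t|
    rw [mul_zero] at hc'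
    refine squeeze_zero (fun _ => dist_nonneg) (fun p => ?_) hc'
    rw [dist_eq_norm, dist_eq_norm]
    exact norm_expGroup_sub_expGroup_apply_le (hB _) (hB _) (hcomm _ _) u t
  choose G hG using fun t f => cauchySeq_tendsto_of_complete (hcauchy t f)
  let U : ℝ → E →L[ℂ] E := fun t =>
    continuousLinearMapOfTendsto (fun k => expGroup (B k) t) (tendsto_pi_nhds.2 (hG t))
  have hU : ∀ t f, Tendsto (fun k => expGroup (B k) t f) atTop (𝓝 (U t f)) := hG
  have hnorm : ∀ t f, ‖U t f‖ = ‖f‖ := fun t f =>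
    tendsto_nhds_unique (hU t f).norm (by simp only [hiso, tendsto_const_nhds])
  have hzero : U 0 = 1 := ContinuousLinearMap.ext fun f =>
    tendsto_nhds_unique (hU 0 f) (by simp only [expGroup_zero, tendsto_const_nhds])
  have hadd : ∀ s t, U (s + t) = U s * U t := fun s t => ContinuousLinearMap.ext fun f => by
    refine tendsto_nhds_unique (hU (s + t) f) ?_
    have h1 : Tendsto (fun k => expGroup (B k) s (expGroup (B k) t f - U t f)) atTop (𝓝 0) := by
      rw [tendsto_zero_iff_norm_tendsto_zero]
      simp only [hiso]
      exact tendsto_iff_norm_sub_tendsto_zero.1 (hU t f)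
    have h2 := h1.add (hU s (U t f))
    rw [zero_add] at h2
    refine h2.congr fun k => ?_
    rw [map_sub, sub_add_cancel, expGroup_add]
    rfl
  have hlip : ∀ s, LipschitzWith 1 (U s) := fun s => by
    refine LipschitzWith.of_dist_le_mul fun x y => ?_
    rw [dist_eq_norm, dist_eq_norm, ← map_sub, hnorm, NNReal.coe_one, one_mul]
  have hcont : ∀ f, Continuous fun t => U t f := by
    intro f
    rw [continuous_iff_continuousAt]
    intro t
    refine tendsto_of_dense (F := fun s => U s) hlip (U t).continuous hH.dense_domain
      (fun u hu => ?_) f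
    rw [tendsto_iff_norm_sub_tendsto_zero]
    have hb : Tendsto (fun s => ‖H ⟨u, hu⟩‖ * |s - t|) (𝓝 t) (𝓝 0) := by
      have : Continuous fun s => ‖H ⟨u, hu⟩‖ * |s - t| := by fun_prop
      simpa using this.tendsto t
    refine squeeze_zero (fun _ => norm_nonneg _) (fun s => ?_) hb
    have h1 := ((hU s u).sub (hU t u)).norm
    have h2 := (hlim ⟨u, hu⟩).norm.mul_const |s - t|
    rw [norm_neg, norm_smul, Complex.norm_I, one_mul] at h2
    exact le_of_tendsto_of_tendsto' h1 h2 fun k => norm_expGroup_apply_sub_le (hB k) u t s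
  have hgen : ∀ u : H.domain, HasDerivAt (fun t => U t u) (-(Complex.I • H u)) 0 := by
    intro u
    set v := -(Complex.I • H u) with hv
    have hconv : ∀ s, Tendsto (fun k => expGroup (B k) s (B k u)) atTop (𝓝 (U s v)) := by
      intro s
      have h1 : Tendsto (fun k => expGroup (B k) s (B k u - v)) atTop (𝓝 0) := by
        rw [tendsto_zero_iff_norm_tendsto_zero]
        simp only [hiso]
        exact tendsto_iff_norm_sub_tendsto_zero.1 (hlim u)
      have h2 := h1.add (hU s v)
      rw [zero_add] at h2
      exact h2.congr fun k => by rw [map_sub, sub_add_cancel]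
    have hcexp : ∀ k f, Continuous fun s => expGroup (B k) s f := fun k f =>
      continuous_iff_continuousAt.2 fun s => (hasDerivAt_expGroup_apply f s).continuousAt
    obtain ⟨M, hM⟩ := (hlim u).norm.bddAbove_range
    -- Derivatives need not pass to the limit directly, but the integrated equation does, by
    -- dominated convergence; differentiating it at `0` gives the generator.
    have hint : ∀ t, U t u - u = ∫ s in (0 : ℝ)..t, U s v := by
      intro t
      have h1 : Tendsto (fun k => ∫ s in (0 : ℝ)..t, expGroup (B k) s (B k u)) atTop
          (𝓝 (∫ s in (0 : ℝ)..t, U s v)) := by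
        refine intervalIntegral.tendsto_integral_filter_of_dominated_convergence (fun _ => M)
          (Eventually.of_forall fun k => (hcexp k _).aestronglyMeasurable)
          (Eventually.of_forall fun k => Eventually.of_forall fun s _ => ?_)
          intervalIntegrable_const (Eventually.of_forall fun s _ => hconv s)
        rw [hiso]
        exact hM ⟨k, rfl⟩
      refine tendsto_nhds_unique ((hU t u).sub_const (u : E)) (h1.congr fun k => ?_)
      rw [intervalIntegral.integral_eq_sub_of_hasDerivAt
        (fun s _ => hasDerivAt_expGroup_apply (u : E) s) ((hcexp k _).intervalIntegrable _ _),
        expGroup_zero]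
      rfl
    have hd := intervalIntegral.integral_hasDerivAt_right (a := 0) (b := 0)
      ((hcont v).intervalIntegrable 0 0) (hcont v).aestronglyMeasurable.stronglyMeasurableAtFilter
      (hcont v).continuousAt
    rw [hzero] at hd
    refine (hd.add_const (u : E)).congr_of_eventuallyEq (Eventually.of_forall fun t => ?_)
    exact sub_eq_iff_eq_add.1 (hint t)
  refine ⟨U, hzero, hadd, hnorm, hcont, fun f g => ⟨fun h => ?_, ?_⟩⟩
  -- Converse direction: differentiating the constant `⟨U t f, U t x⟩` at `0` yields `⟨g, x⟩ = ⟨f, H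
  -- x⟩` for all `x` in the domain, and maximal symmetry applies.
  · refine mem_domain_of_isSelfAdjoint hH fun x => ?_
    have hconst : ∀ t, ⟪U t f, U t x⟫_ℂ = ⟪f, (x : E)⟫_ℂ := fun t =>
      (⟨(U t).toLinearMap, hnorm t⟩ : E →ₗᵢ[ℂ] E).inner_map_map f x
    have h1 := h.inner ℂ (hgen x)
    simp only [hconst, hzero] at h1
    have h2 := h1.unique (hasDerivAt_const _ _)
    simp only [one_apply_eq_self, inner_neg_right, inner_neg_left, inner_smul_left,
      inner_smul_right, Complex.conj_I] at h2
    have h3 : Complex.I * (⟪g, (x : E)⟫_ℂ - ⟪f, H x⟫_ℂ) = 0 := by linear_combination h2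
    exact sub_eq_zero.1 ((mul_eq_zero.1 h3).resolve_left Complex.I_ne_zero)
  · rintro ⟨hf, rfl⟩
    exact hgen ⟨f, hf⟩

end Stone

/-! ### Smooth operators and the weak time integral -/

section Smoothness

variable {E : Type*} [NormedAddCommGroup E] [InnerProductSpace ℂ E]
  {H : E →ₗ.[ℂ] E} {U : ℝ → E →L[ℂ] E}

/-- Strong continuity of a product of two strongly continuous families, the first isometric. -/
theorem IsUnitaryGroupOf.continuous_neg_apply (hU : IsUnitaryGroupOf H U) {g : ℝ → E}
    (hg : Continuous g) : Continuous fun s => U (-s) (g s) := by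
  rw [continuous_iff_continuousAt]
  intro t
  have h1 : Tendsto (fun s => U (-s) (g s - g t)) (𝓝 t) (𝓝 0) := by
    rw [tendsto_zero_iff_norm_tendsto_zero]
    simp only [hU.norm_map]
    rw [← tendsto_zero_iff_norm_tendsto_zero, ← sub_self (g t)]
    exact (hg.tendsto t).sub_const _
  have h2 : Tendsto (fun s => U (-s) (g t)) (𝓝 t) (𝓝 (U (-t) (g t))) :=
    ((hU.continuous (g t)).comp continuous_neg).tendsto t
  have h3 := h1.add h2
  rw [zero_add] at h3
  exact h3.congr fun s => by rw [map_sub, sub_add_cancel]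

/-- The tail integrals of an integrable function tend to zero. -/
theorem tendsto_integral_Ioi_atTop {F : Type*} [NormedAddCommGroup F] [NormedSpace ℝ F]
    {f : ℝ → F} (hf : IntegrableOn f (Set.Ioi 0)) :
    Tendsto (fun T : ℝ => ∫ s in Set.Ioi T, f s) atTop (𝓝 0) := by
  have h := (tendsto_const_nhds (x := ∫ s in Set.Ioi (0 : ℝ), f s)).sub
    (intervalIntegral_tendsto_integral_Ioi 0 hf tendsto_id)
  rw [sub_self] at h
  refine h.congr' ?_
  filter_upwards [eventually_ge_atTop (0 : ℝ)] with T hT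
  rw [id, sub_eq_iff_eq_add, add_comm]
  exact (intervalIntegral.integral_interval_add_Ioi hf
    (hf.mono_set (Set.Ioi_subset_Ioi hT))).symm

/-- `W` is `H`-smooth on the continuous spectral subspace, with respect to the group `U`. -/
def IsSmoothOn (H : E →ₗ.[ℂ] E) (U : ℝ → E →L[ℂ] E) (W : E →L[ℂ] E) (C : ℝ) : Prop :=
  ∀ ψ ∈ continuousSubspace H, IntegrableOn (fun s => ‖W (U s ψ)‖ ^ 2) (Set.Ioi 0) ∧
    ∫ s in Set.Ioi (0 : ℝ), ‖W (U s ψ)‖ ^ 2 ≤ C * ‖ψ‖ ^ 2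

variable [CompleteSpace E] {W M : E →L[ℂ] E} {C K : ℝ}

/-- The integrand `e^{iHs} (-M) e^{-iHs} P_c(H) φ` for a bounded operator `M`. -/
noncomputable def conjugated (H : E →ₗ.[ℂ] E) (U : ℝ → E →L[ℂ] E) (M : E →L[ℂ] E) (φ : E)
    (s : ℝ) : E :=
  U (-s) (-M (U s (Pc H φ)))

theorem IsUnitaryGroupOf.continuous_conjugated (hU : IsUnitaryGroupOf H U) (φ : E) :
    Continuous (conjugated H U M φ) :=
  hU.continuous_neg_apply (M.continuous.comp (hU.continuous _)).neg

theorem IsUnitaryGroupOf.inner_conjugated (hU : IsUnitaryGroupOf H U) (ψ φ : E) (s : ℝ) :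
    ⟪ψ, conjugated H U M φ s⟫_ℂ = -⟪U s ψ, M (U s (Pc H φ))⟫_ℂ := by
  rw [conjugated, hU.inner_apply_right, neg_neg, inner_neg_right]

variable (hU : IsUnitaryGroupOf H U) (hW : IsSmoothOn H U W C)
  (hM : ∀ a b, ‖⟪a, M b⟫_ℂ‖ ≤ K * (‖W a‖ * ‖W b‖))

include hU hW in
omit [CompleteSpace E] in
theorem IsSmoothOn.memLp {ψ : E} (hψ : ψ ∈ continuousSubspace H) {T : ℝ} (hT : 0 ≤ T) :
    MemLp (fun s => W (U s ψ)) 2 (volume.restrict (Set.Ioi T)) :=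
  (memLp_two_iff_integrable_sq_norm
    (W.continuous.comp (hU.continuous ψ)).aestronglyMeasurable).2
    ((hW ψ hψ).1.mono_set (Set.Ioi_subset_Ioi hT))

include hU hW hM in
theorem integrableOn_inner_conjugated {ψ : E} (hψ : ψ ∈ continuousSubspace H) (φ : E) :
    IntegrableOn (fun s => ⟪ψ, conjugated H U M φ s⟫_ℂ) (Set.Ioi 0) := by
  have h := ((hW.memLp hU hψ le_rfl).norm.integrable_mul
    (hW.memLp hU (Pc_mem φ) le_rfl).norm).const_mul K
  refine h.mono' (continuous_const.inner (hU.continuous_conjugated φ)).aestronglyMeasurable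
    (Eventually.of_forall fun s => ?_)
  rw [hU.inner_conjugated, norm_neg]
  exact hM _ _

include hU hW hM in
-- Cauchy–Schwarz in time. The factor of `ψ` is enlarged to the whole half-line, while the tail of
-- `φ` is kept: it gives smallness as `T → ∞`, uniformly over bounded `ψ`.
theorem norm_integral_inner_conjugated_le (hK : 0 ≤ K) {ψ : E} (hψ : ψ ∈ continuousSubspace H)
    (φ : E) {T : ℝ} (hT : 0 ≤ T) :
    ‖∫ s in Set.Ioi T, ⟪ψ, conjugated H U M φ s⟫_ℂ‖ ≤
      K * (√C * ‖ψ‖ * √(∫ s in Set.Ioi T, ‖W (U s (Pc H φ))‖ ^ 2)) := by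
  have hψ' := hW.memLp hU hψ hT
  have hφ' := hW.memLp hU (Pc_mem φ) hT
  have h2 : ENNReal.ofReal 2 = 2 := by simp
  have hcs := integral_mul_norm_le_Lp_mul_Lq Real.HolderConjugate.two_two
    (h2.symm ▸ hψ') (h2.symm ▸ hφ')
  simp only [← Real.sqrt_eq_rpow, Real.rpow_two] at hcs
  calc
    _ ≤ ∫ s in Set.Ioi T, K * (‖W (U s ψ)‖ * ‖W (U s (Pc H φ))‖) := by
      refine norm_integral_le_of_norm_le ((hψ'.norm.integrable_mul hφ'.norm).const_mul K)
        (Eventually.of_forall fun s => ?_)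
      rw [hU.inner_conjugated, norm_neg]
      exact hM _ _
    _ ≤ K * (√(∫ s in Set.Ioi T, ‖W (U s ψ)‖ ^ 2) *
          √(∫ s in Set.Ioi T, ‖W (U s (Pc H φ))‖ ^ 2)) := by
      rw [integral_const_mul]
      gcongr
    _ ≤ _ := by
      gcongr
      rw [← Real.sqrt_sq (norm_nonneg ψ), ← Real.sqrt_mul' _ (sq_nonneg _)]
      refine Real.sqrt_le_sqrt (le_trans ?_ (hW ψ hψ).2)
      exact setIntegral_mono_set (hW ψ hψ).1 (Eventually.of_forall fun s => sq_nonneg _)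
        (Set.Ioi_subset_Ioi hT).eventuallyLE

theorem conjugated_add (φ φ' : E) (s : ℝ) :
    conjugated H U M (φ + φ') s = conjugated H U M φ s + conjugated H U M φ' s := by
  simp only [conjugated, map_add, map_neg]
  abel

theorem conjugated_smul (a : ℂ) (φ : E) (s : ℝ) :
    conjugated H U M (a • φ) s = a • conjugated H U M φ s := by
  simp only [conjugated, map_smul, map_neg, smul_neg]

include hU hW hM in
/-- The weak integral of the conjugated operators is a bounded operator with range in the
continuous spectral subspace. -/
theorem exists_weak_integral (hK : 0 ≤ K) :
    ∃ B : E →L[ℂ] E, ∀ ψ φ : E,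
      ∫ s in Set.Ioi (0 : ℝ), ⟪Pc H ψ, conjugated H U M φ s⟫_ℂ = ⟪ψ, B φ⟫_ℂ := by
  have hint := fun ψ φ => integrableOn_inner_conjugated hU hW hM (Pc_mem (H := H) ψ) φ
  let b : E →ₗ⋆[ℂ] E →ₗ[ℂ] ℂ := LinearMap.mk₂'ₛₗ (starRingEnd ℂ) (RingHom.id ℂ)
    (fun ψ φ => ∫ s in Set.Ioi (0 : ℝ), ⟪Pc H ψ, conjugated H U M φ s⟫_ℂ)
    (fun ψ ψ' φ => by
      simp only [map_add, inner_add_left]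
      exact integral_add (hint ψ φ) (hint ψ' φ))
    (fun a ψ φ => by
      simp only [map_smul, inner_smul_left]
      exact integral_const_mul _ _)
    (fun ψ φ φ' => by
      simp only [conjugated_add, inner_add_right]
      exact integral_add (hint ψ φ) (hint ψ φ'))
    (fun a ψ φ => by
      simp only [conjugated_smul, inner_smul_right]
      exact integral_const_mul _ _)
  let bc : E →L⋆[ℂ] E →L[ℂ] ℂ := b.mkContinuous₂ (K * (√C * √C)) fun ψ φ => by
    refine (norm_integral_inner_conjugated_le hU hW hM hK (Pc_mem ψ) φ le_rfl).trans ?_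
    have h1 : √(∫ s in Set.Ioi (0 : ℝ), ‖W (U s (Pc H φ))‖ ^ 2) ≤ √C * ‖φ‖ := by
      refine (Real.sqrt_le_sqrt (hW _ (Pc_mem φ)).2).trans ?_
      rw [Real.sqrt_mul' _ (sq_nonneg _), Real.sqrt_sq (norm_nonneg _)]
      gcongr
      exact norm_Pc_apply_le φ
    calc
      _ ≤ K * (√C * ‖ψ‖ * (√C * ‖φ‖)) := by
        gcongr
        exact norm_Pc_apply_le ψ
      _ = _ := by ring
  -- The operator representing `bc` acts on the left, conjugate-linear argument `ψ`; its adjoint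
  -- moves the action to `φ`.
  refine ⟨(InnerProductSpace.continuousLinearMapOfBilin bc).adjoint, fun ψ φ => ?_⟩
  rw [ContinuousLinearMap.adjoint_inner_right,
    InnerProductSpace.continuousLinearMapOfBilin_apply]
  rfl

include hU hW hM in
/-- Strong convergence of the truncated integrals to the weak integral. -/
theorem tendsto_Pc_integral_conjugated (hK : 0 ≤ K) {B : E →L[ℂ] E}
    (hB : ∀ ψ φ : E, ∫ s in Set.Ioi (0 : ℝ), ⟪Pc H ψ, conjugated H U M φ s⟫_ℂ = ⟪ψ, B φ⟫_ℂ)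
    (φ : E) :
    Tendsto (fun T : ℝ => Pc H (∫ s in (0 : ℝ)..T, conjugated H U M φ s)) atTop (𝓝 (B φ)) := by
  have hint := fun ψ => integrableOn_inner_conjugated hU hW hM (Pc_mem (H := H) ψ) φ
  have htail : Tendsto (fun T : ℝ => K * (√C * √(∫ s in Set.Ioi T, ‖W (U s (Pc H φ))‖ ^ 2)))
      atTop (𝓝 0) := by
    have h := (tendsto_integral_Ioi_atTop (hW _ (Pc_mem φ)).1).sqrt
    rw [Real.sqrt_zero] at h
    simpa using (h.const_mul (√C)).const_mul K
  rw [tendsto_iff_norm_sub_tendsto_zero]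
  refine squeeze_zero' (Eventually.of_forall fun _ => norm_nonneg _) ?_ htail
  filter_upwards [eventually_ge_atTop (0 : ℝ)] with T hT
  have key : ∀ ψ, ⟪ψ, Pc H (∫ s in (0 : ℝ)..T, conjugated H U M φ s) - B φ⟫_ℂ =
      -∫ s in Set.Ioi T, ⟪Pc H ψ, conjugated H U M φ s⟫_ℂ := by
    intro ψ
    have h1 : ⟪Pc H ψ, ∫ s in (0 : ℝ)..T, conjugated H U M φ s⟫_ℂ =
        ∫ s in (0 : ℝ)..T, ⟪Pc H ψ, conjugated H U M φ s⟫_ℂ :=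
      ((innerSL ℂ (Pc H ψ)).intervalIntegral_comp_comm
        ((hU.continuous_conjugated φ).intervalIntegrable 0 T)).symm
    rw [inner_sub_right, ← inner_Pc_left, h1, ← hB ψ φ,
      ← intervalIntegral.integral_interval_add_Ioi (hint ψ)
        ((hint ψ).mono_set (Set.Ioi_subset_Ioi hT))]
    ring
  set d := Pc H (∫ s in (0 : ℝ)..T, conjugated H U M φ s) - B φ with hd
  -- Testing the weak tail bound against the error `d` itself turns it into a norm bound.
  have hdd : ‖d‖ * ‖d‖ ≤
      (K * (√C * √(∫ s in Set.Ioi T, ‖W (U s (Pc H φ))‖ ^ 2))) * ‖d‖ := by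
    have h := norm_integral_inner_conjugated_le hU hW hM hK (Pc_mem d) φ hT
    rw [← norm_neg, ← key d, inner_self_eq_norm_sq_to_K, norm_pow, RCLike.norm_ofReal,
      abs_norm, sq] at h
    calc
      _ ≤ _ := h
      _ ≤ K * (√C * ‖d‖ * √(∫ s in Set.Ioi T, ‖W (U s (Pc H φ))‖ ^ 2)) := by
        gcongr
        exact norm_Pc_apply_le d
      _ = _ := by ring
  rcases (norm_nonneg d).eq_or_lt with h0 | h0
  · rw [← h0]; positivity
  · exact le_of_mul_le_mul_right hdd h0

include hU hW hM in
/-- The weak integral solves the commutator equation `i[H, B] = M P_c(H)` as forms. -/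
theorem commutator_weak_integral {B : E →L[ℂ] E}
    (hB : ∀ ψ φ : E, ∫ s in Set.Ioi (0 : ℝ), ⟪Pc H ψ, conjugated H U M φ s⟫_ℂ = ⟪ψ, B φ⟫_ℂ)
    (ψ φ : H.domain) (hψ : (ψ : E) ∈ continuousSubspace H) :
    Complex.I * (⟪H ψ, B φ⟫_ℂ - ⟪(ψ : E), B (H φ)⟫_ℂ) = ⟪(ψ : E), M (Pc H φ)⟫_ℂ := by
  have hHψ := hU.map_mem_continuousSubspace ψ hψ
  have i1 := integrableOn_inner_conjugated hU hW hM hHψ (φ : E)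
  have i2 := integrableOn_inner_conjugated hU hW hM hψ (H φ)
  have i3 := integrableOn_inner_conjugated hU hW hM hψ (φ : E)
  obtain ⟨hPφ, hHPφ⟩ := hU.map_Pc φ
  have hderiv : ∀ s, HasDerivAt (fun s => ⟪(ψ : E), conjugated H U M φ s⟫_ℂ)
      (Complex.I * (⟪H ψ, conjugated H U M φ s⟫_ℂ - ⟪(ψ : E), conjugated H U M (H φ) s⟫_ℂ)) s := by
    intro s
    have d1 := hU.hasDerivAt ψ s
    have d2 := (M.restrictScalars ℝ).hasFDerivAt.comp_hasDerivAt s (hU.hasDerivAt ⟨_, hPφ⟩ s)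
    have d := (d1.inner ℂ d2).neg
    simp only [ContinuousLinearMap.coe_restrictScalars', Function.comp_apply] at d
    simp only [hU.inner_conjugated]
    refine d.congr_deriv ?_
    rw [hHPφ]
    simp only [map_neg, map_smul, inner_neg_right, inner_neg_left, inner_smul_left,
      inner_smul_right, Complex.conj_I]
    ring
  have hI := (i1.sub i2).const_mul Complex.I
  -- An integrable function with integrable derivative vanishes at infinity, so only the boundary
  -- term at `0` remains.
  have hlim := tendsto_zero_of_hasDerivAt_of_integrableOn_Ioi (fun s _ => hderiv s) hI i3
  have h := integral_Ioi_of_hasDerivAt_of_tendsto' (fun s _ => hderiv s) hI hlim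
  have e1 := hB (H ψ) φ
  have e2 := hB ψ (H φ)
  rw [Pc_eq_self hHψ] at e1
  rw [Pc_eq_self hψ] at e2
  rw [← e1, ← e2, ← integral_sub i1 i2, ← integral_const_mul, h, hU.inner_conjugated, hU.zero]
  simp

end Smoothness

/-! ### Multiplication operators on `L²` -/

section Multiplication

variable {n : ℕ} {q r : EuclideanSpace ℝ (Fin n) → ℝ} {K : ℝ}

theorem memLp_smul_of_bound (hq : AEStronglyMeasurable q volume) (hK : ∀ᵐ x, |q x| ≤ K)
    (f : L2 n) : MemLp (fun x => q x • f x) 2 volume := by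
  refine (Lp.memLp f).of_le_mul (c := K) (hq.smul (Lp.aestronglyMeasurable f)) ?_
  filter_upwards [hK] with x hx
  rw [norm_smul, Real.norm_eq_abs]
  gcongr

theorem coeFn_mulFun (hq : AEStronglyMeasurable q volume) (hK : ∀ᵐ x, |q x| ≤ K) (f : L2 n) :
    mulFun q f =ᵐ[volume] fun x => q x • f x := by
  rw [mulFun, dif_pos (memLp_smul_of_bound hq hK f)]
  exact MemLp.coeFn_toLp _

theorem mulFun_zero : mulFun q (0 : L2 n) = 0 := by
  rw [mulFun]
  split_ifs with h
  · refine Lp.ext ?_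
    filter_upwards [h.coeFn_toLp, Lp.coeFn_zero ℂ 2 (volume : Measure (EuclideanSpace ℝ (Fin n)))]
      with x h1 h2
    rw [h1, h2, Pi.zero_apply, smul_zero]
  · rfl

theorem norm_mulFun_le (hq : AEStronglyMeasurable q volume) (hK : ∀ᵐ x, |q x| ≤ K) (f : L2 n) :
    ‖mulFun q f‖ ≤ K * ‖f‖ := by
  refine Lp.norm_le_mul_norm_of_ae_le_mul ?_
  filter_upwards [coeFn_mulFun hq hK f, hK] with x h1 h2
  rw [h1, norm_smul, Real.norm_eq_abs]
  gcongr

/-- Multiplication by a bounded measurable function as a bounded operator. -/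
noncomputable def mulCLM (q : EuclideanSpace ℝ (Fin n) → ℝ)
    (hq : AEStronglyMeasurable q volume) (hK : ∀ᵐ x, |q x| ≤ K) : L2 n →L[ℂ] L2 n :=
  LinearMap.mkContinuous
    { toFun := mulFun q
      map_add' := fun f g => by
        refine Lp.ext ?_
        filter_upwards [coeFn_mulFun hq hK f, coeFn_mulFun hq hK g, coeFn_mulFun hq hK (f + g),
          Lp.coeFn_add f g, Lp.coeFn_add (mulFun q f) (mulFun q g)] with x h1 h2 h3 h4 h5
        simp only [h3, h4, h5, Pi.add_apply, h1, h2, smul_add]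
      map_smul' := fun a f => by
        refine Lp.ext ?_
        filter_upwards [coeFn_mulFun hq hK f, coeFn_mulFun hq hK (a • f),
          Lp.coeFn_smul a f, Lp.coeFn_smul a (mulFun q f)] with x h1 h2 h3 h4
        simp only [RingHom.id_apply, h2, h3, h4, Pi.smul_apply, h1]
        exact smul_comm _ _ _ } K
    (norm_mulFun_le hq hK)

theorem inner_mulFun_left (hq : AEStronglyMeasurable q volume) (hK : ∀ᵐ x, |q x| ≤ K)
    (f g : L2 n) : ⟪mulFun q f, g⟫_ℂ = ⟪f, mulFun q g⟫_ℂ := by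
  rw [L2.inner_def, L2.inner_def]
  refine integral_congr_ae ?_
  filter_upwards [coeFn_mulFun hq hK f, coeFn_mulFun hq hK g] with x h1 h2
  rw [h1, h2, ← Complex.coe_smul, ← Complex.coe_smul, inner_smul_left, inner_smul_right,
    Complex.conj_ofReal]

theorem lintegral_enorm_smul_sq (hq : AEStronglyMeasurable q volume) (hK : ∀ᵐ x, |q x| ≤ K)
    (f : L2 n) : ∫⁻ x, ‖q x • f x‖ₑ ^ 2 = ‖mulFun q f‖ₑ ^ 2 := by
  have h : ∫⁻ x, ‖q x • f x‖ₑ ^ 2 = ∫⁻ x, ‖mulFun q f x‖ₑ ^ 2 := by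
    refine lintegral_congr_ae ?_
    filter_upwards [coeFn_mulFun hq hK f] with x h1
    rw [h1]
  rw [h, Lp.enorm_def]
  have h2 := eLpNorm_nnreal_pow_eq_lintegral (f := mulFun q f) (p := 2)
    (μ := (volume : Measure (EuclideanSpace ℝ (Fin n)))) two_ne_zero
  simp only [NNReal.coe_ofNat, ENNReal.coe_ofNat, ENNReal.rpow_ofNat] at h2
  exact h2.symm

end Multiplication

/-! ### The weight `⟨x⟩^{-σ}` and local decay -/

section Bracket

variable {n : ℕ} {σ c : ℝ} {H : L2 n →ₗ.[ℂ] L2 n}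

theorem one_le_bracket (x : EuclideanSpace ℝ (Fin n)) : 1 ≤ bracket x :=
  Real.one_le_sqrt.2 (by nlinarith [sq_nonneg ‖x‖])

theorem bracket_pos (x : EuclideanSpace ℝ (Fin n)) : 0 < bracket x :=
  one_pos.trans_le (one_le_bracket x)

theorem continuous_bracket_rpow (a : ℝ) :
    Continuous fun x : EuclideanSpace ℝ (Fin n) => bracket x ^ a := by
  refine Continuous.rpow_const ?_ fun x => Or.inl (bracket_pos x).ne'
  unfold bracket
  fun_prop

theorem abs_bracket_rpow_neg_le (hσ : 0 ≤ σ) :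
    ∀ᵐ x : EuclideanSpace ℝ (Fin n), |bracket x ^ (-σ)| ≤ 1 :=
  Eventually.of_forall fun x => by
    rw [abs_of_nonneg (Real.rpow_nonneg (bracket_pos x).le _)]
    exact Real.rpow_le_one_of_one_le_of_nonpos (one_le_bracket x) (neg_nonpos.2 hσ)

/-- Multiplication by `⟨x⟩^{-σ}` on `L²`, for `σ ≥ 0`. -/
noncomputable def weight (n : ℕ) (hσ : 0 ≤ σ) : L2 n →L[ℂ] L2 n :=
  mulCLM (fun x => bracket x ^ (-σ)) (continuous_bracket_rpow _).aestronglyMeasurable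
    (abs_bracket_rpow_neg_le hσ)

/-- Local decay says that the weight is smooth on the continuous spectral subspace. -/
theorem LocalDecay.isSmoothOn (hU : IsUnitaryGroupOf H (evolution H)) (hd : LocalDecay H σ c)
    (hσ : 0 ≤ σ) : IsSmoothOn H (evolution H) (weight n hσ) (max c 0) := by
  intro ψ hψ
  have h := hd ψ hψ
  have e : ∀ t, ∫⁻ x, ‖bracket x ^ (-σ) • (evolution H t ψ) x‖ₑ ^ 2 =
      ‖‖weight n hσ (evolution H t ψ)‖ ^ 2‖ₑ := by
    intro t
    rw [lintegral_enorm_smul_sq (q := fun x => bracket x ^ (-σ))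
      (continuous_bracket_rpow _).aestronglyMeasurable (abs_bracket_rpow_neg_le hσ),
      enorm_pow, enorm_norm]
    rfl
  simp only [e] at h
  have hm : AEStronglyMeasurable (fun t => ‖weight n hσ (evolution H t ψ)‖ ^ 2)
      (volume.restrict (Set.Ioi 0)) :=
    (((weight n hσ).continuous.comp (hU.continuous ψ)).norm.pow 2).aestronglyMeasurable
  have hfin : ENNReal.ofReal c * ‖ψ‖ₑ ^ 2 ≠ ⊤ := by finiteness
  refine ⟨⟨hm, h.trans_lt hfin.lt_top⟩, ?_⟩
  rw [integral_eq_lintegral_of_nonneg_ae (Eventually.of_forall fun t => sq_nonneg _) hm]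
  refine (ENNReal.toReal_mono hfin (le_trans (lintegral_mono fun t => ?_) h)).trans ?_
  · exact (Real.enorm_of_nonneg (sq_nonneg _)).ge
  -- `ENNReal.ofReal` truncates negative `c` to `0`, whence the constant `max c 0`.
  · rw [ENNReal.toReal_mul, ENNReal.toReal_ofReal', ENNReal.toReal_pow, toReal_enorm]

/-- Local decay for `σ ≤ 0` excludes a continuous spectral subspace. -/
theorem LocalDecay.continuousSubspace_eq_bot (hU : IsUnitaryGroupOf H (evolution H))
    (hd : LocalDecay H σ c) (hσ : σ ≤ 0) : continuousSubspace H = ⊥ := by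
  refine (Submodule.eq_bot_iff _).2 fun ψ hψ => ?_
  by_contra h0
  have hlow : ∀ t, ‖ψ‖ₑ ^ 2 ≤ ∫⁻ x, ‖bracket x ^ (-σ) • (evolution H t ψ) x‖ₑ ^ 2 := by
    intro t
    have h1 := lintegral_enorm_smul_sq (q := fun _ => (1 : ℝ)) (K := 1)
      aestronglyMeasurable_const (by simp) (evolution H t ψ)
    have h2 : mulFun (fun _ => (1 : ℝ)) (evolution H t ψ) = evolution H t ψ := by
      refine Lp.ext ?_
      filter_upwards [coeFn_mulFun (q := fun _ => (1 : ℝ)) (K := 1)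
        aestronglyMeasurable_const (by simp) (evolution H t ψ)] with x hx
      rw [hx, one_smul]
    rw [h2, ← enorm_norm, hU.norm_map, enorm_norm] at h1
    rw [← h1]
    refine lintegral_mono fun x => ?_
    rw [enorm_smul, enorm_smul]
    gcongr
    rw [Real.enorm_of_nonneg zero_le_one,
      Real.enorm_of_nonneg (Real.rpow_nonneg (bracket_pos x).le _)]
    exact ENNReal.ofReal_le_ofReal (Real.one_le_rpow (one_le_bracket x) (neg_nonneg.2 hσ))
  have h := (lintegral_mono hlow).trans (hd ψ hψ)
  -- A positive constant integrates to `⊤` over the half-line, against the finite bound from local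
  -- decay.
  rw [lintegral_const, Measure.restrict_apply_univ, Real.volume_Ioi, ENNReal.mul_top] at h
  · exact (ENNReal.mul_lt_top ENNReal.ofReal_lt_top (by finiteness)).not_ge h
  · simpa using h0

/-- A function that is bounded by a multiple of `⟨x⟩^{-2σ}` is relatively form bounded by the
square of the weight. -/
theorem norm_inner_mulFun_le (hσ : 0 ≤ σ) {Q : EuclideanSpace ℝ (Fin n) → ℝ} {K : ℝ}
    (hm : AEStronglyMeasurable Q volume) (hQ : ∀ᵐ x, bracket x ^ (2 * σ) * |Q x| ≤ K)
    (a b : L2 n) : ‖⟪a, mulFun Q b⟫_ℂ‖ ≤ K * (‖weight n hσ a‖ * ‖weight n hσ b‖) := by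
  have hw := (continuous_bracket_rpow (n := n) (-σ)).aestronglyMeasurable (μ := volume)
  have hw1 := abs_bracket_rpow_neg_le (n := n) hσ
  have hN := ((continuous_bracket_rpow (n := n) (2 * σ)).aestronglyMeasurable (μ := volume)).mul hm
  have hN1 : ∀ᵐ x, |bracket x ^ (2 * σ) * Q x| ≤ K := hQ.mono fun x hx => by
    rwa [abs_mul, abs_of_nonneg (Real.rpow_nonneg (bracket_pos x).le _)]
  -- The factorization `Q = w N w`; one `w` is then moved to `a` by symmetry.
  have e : mulFun Q b = mulFun (fun x => bracket x ^ (-σ))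
      (mulFun (fun x => bracket x ^ (2 * σ) * Q x) (weight n hσ b)) := by
    refine Lp.ext ?_
    have hQK : ∀ᵐ x, |Q x| ≤ K := hQ.mono fun x hx =>
      (le_mul_of_one_le_left (abs_nonneg _)
        (Real.one_le_rpow (one_le_bracket x) (by positivity))).trans hx
    filter_upwards [coeFn_mulFun hm hQK b, coeFn_mulFun hw hw1 b,
      coeFn_mulFun hN hN1 (weight n hσ b),
      coeFn_mulFun hw hw1 (mulFun (fun x => bracket x ^ (2 * σ) * Q x) (weight n hσ b))]
      with x h1 h2 h3 h4
    have h2' : weight n hσ b x = bracket x ^ (-σ) • b x := h2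
    rw [h1, h4]
    refine Eq.trans ?_ (congrArg _ h3.symm)
    rw [h2', smul_smul, smul_smul]
    congr 1
    have h5 : bracket x ^ (-σ) * bracket x ^ (2 * σ) * bracket x ^ (-σ) = 1 := by
      rw [← Real.rpow_add (bracket_pos x), ← Real.rpow_add (bracket_pos x)]
      ring_nf
      exact Real.rpow_zero _
    simp only [Pi.mul_apply]
    linear_combination (-Q x) * h5
  rw [e, ← inner_mulFun_left hw hw1]
  refine (norm_inner_le_norm _ _).trans ?_
  calc
    _ ≤ ‖weight n hσ a‖ * (K * ‖weight n hσ b‖) := by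
      gcongr
      · exact le_rfl
      · exact norm_mulFun_le hN hN1 _
    _ = _ := by ring

end Bracket

end Adaptor

/-! ### Assembly of the main theorem -/

open Adaptor in
theorem mainTheorem5 {n : ℕ} (V Q : EuclideanSpace ℝ (Fin n) → ℝ)
    (H : Adaptor.L2 n →ₗ.[ℂ] Adaptor.L2 n) (hH : Adaptor.IsSchrodingerOperator V H)
    (σ c : ℝ) (hdecay : Adaptor.LocalDecay H σ c)
    (LapQ : EuclideanSpace ℝ (Fin n) → ℝ) (hLapQ : Adaptor.IsWeakLaplacian Q LapQ)
    (K : ℝ) (hQ : ∀ᵐ x, Adaptor.bracket x ^ (2 * σ) * (|Q x| + |LapQ x|) ≤ K) :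
    ∃ B : Adaptor.L2 n →L[ℂ] Adaptor.L2 n,
      -- the integral converges absolutely as a sesquilinear form, and represents `B`
      (∀ ψ ∈ Adaptor.continuousSubspace H, ∀ φ : Adaptor.L2 n,
        IntegrableOn (fun s => ⟪ψ, Adaptor.integrand H Q φ s⟫_ℂ) (Set.Ioi 0) ∧
        ∫ s in Set.Ioi (0 : ℝ), ⟪ψ, Adaptor.integrand H Q φ s⟫_ℂ = ⟪ψ, B φ⟫_ℂ) ∧
      -- the truncated integrals converge strongly to `B` in the continuous subspace
      (∀ φ : Adaptor.L2 n,
        (∀ T : ℝ, IntervalIntegrable (Adaptor.integrand H Q φ) volume 0 T) ∧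
        Tendsto (fun T : ℝ => Adaptor.Pc H (∫ s in (0 : ℝ)..T, Adaptor.integrand H Q φ s))
          atTop (𝓝 (B φ))) ∧
      -- `i[H, B] = Q P_c(H)` as forms
      (∀ ψ φ : H.domain, (ψ : Adaptor.L2 n) ∈ Adaptor.continuousSubspace H →
        Complex.I * (⟪H ψ, B φ⟫_ℂ - ⟪(ψ : Adaptor.L2 n), B (H φ)⟫_ℂ) =
          ⟪(ψ : Adaptor.L2 n), Adaptor.mulFun Q (Adaptor.Pc H φ)⟫_ℂ) := by
  have hU : IsUnitaryGroupOf H (evolution H) := evolution_spec (exists_isUnitaryGroupOf hH.selfAdjoint)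
  rcases le_total 0 σ with hσ | hσ
  · have hm : AEStronglyMeasurable Q volume := hLapQ.1.aestronglyMeasurable
    have hQK : ∀ᵐ x, bracket x ^ (2 * σ) * |Q x| ≤ |K| := hQ.mono fun x hx => by
      refine le_trans ?_ (hx.trans (le_abs_self K))
      have := Real.rpow_nonneg (bracket_pos x).le (2 * σ)
      gcongr
      exact le_add_of_nonneg_right (abs_nonneg _)
    have hQb : ∀ᵐ x, |Q x| ≤ |K| := hQK.mono fun x hx =>
      (le_mul_of_one_le_left (abs_nonneg _)
        (Real.one_le_rpow (one_le_bracket x) (by positivity))).trans hx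
    have hW := hdecay.isSmoothOn hU hσ
    -- `mulCLM Q` acts as `mulFun Q` by definition, so `conjugated` and `integrand` agree
    -- definitionally below. Using `|K|` supplies the nonnegative constant that the estimates
    -- require.
    have hM : ∀ a b, ‖⟪a, mulCLM Q hm hQb b⟫_ℂ‖ ≤ |K| * (‖weight n hσ a‖ * ‖weight n hσ b‖) :=
      norm_inner_mulFun_le hσ hm hQK
    obtain ⟨B, hB⟩ := exists_weak_integral hU hW hM (abs_nonneg K)
    refine ⟨B, fun ψ hψ φ => ⟨integrableOn_inner_conjugated hU hW hM hψ φ, ?_⟩,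
      fun φ => ⟨fun T => (hU.continuous_conjugated (M := mulCLM Q hm hQb) φ).intervalIntegrable 0 T,
        tendsto_Pc_integral_conjugated hU hW hM (abs_nonneg K) hB φ⟩,
      commutator_weak_integral hU hW hM hB⟩
    rw [← hB, Pc_eq_self hψ]
    rfl
  -- For `σ ≤ 0` the continuous subspace is zero, so `P_c = 0` and `B = 0` works.
  · have hbot := hdecay.continuousSubspace_eq_bot hU hσ
    have hPc : ∀ f : L2 n, Pc H f = 0 := fun f => by
      have h := Pc_mem (H := H) f
      rwa [hbot, Submodule.mem_bot] at h
    have hint : ∀ φ, integrand H Q φ = 0 := fun φ => funext fun s => by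
      simp [integrand, hPc, mulFun_zero]
    refine ⟨0, fun ψ _ φ => ?_, fun φ => ⟨fun T => ?_, ?_⟩, fun ψ φ _ => ?_⟩
    · simp [hint]
    · rw [hint]
      exact intervalIntegrable_const
    · simp [hint]
    · simp [hPc, mulFun_zero]
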